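/- Let $\mathcal F$ be the set of all entire functions $\Phi(z)=\sum_{n\ge 0}a_nz^n$ on $\mathbb C$ with $a_n\ge 0$ for all $n\ge 0$ and $a_n>0$ for some $n\ge 1$. Let $\mathcal H$ be a complex Hilbert space and $\Phi\in\mathcal F$. Let $\Phi(\mathcal H)$ be the reproducing kernel Hilbert space of functions on $\mathcal H$ with reproducing kernel $K^\Phi(\xi,\eta)=\Phi(\langle\xi,\eta\rangle)$, and let $\mathcal K^\Phi$ be the linear span of the functions $K^\Phi_\xi=K^\Phi(\cdot,\xi)$, $\xi\in\mathcal H$. For a bounded operator $A$ on $\mathcal H$, let $C_A$ be the (possibly unbounded) operator in $\Phi(\mathcal H)$ with domain $\mathcal D(C_A)=\{f\in\Phi(\mathcal H): f\circ A\in\Phi(\mathcal H)\}$ and $C_Af=f\circ A$. A densely defined operator $T$ in a Hilbert space is called hyponormal if $\mathcal D(T)\subseteq\mathcal D(T^*)$ and $\|T^*\xi\|\le\|T\xi\|$ for all $\xi\in\mathcal D(T)$, and cohyponormal if $\mathcal D(T^*)\subseteq\mathcal D(T)$ and $\|T\xi\|\le\|T^*\xi\|$ for all $\xi\in\mathcal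 D(T^*)$. Let $A,B$ be bounded operators on $\mathcal H$. Then $\mathcal K^\Phi\subseteq\mathcal D(C_A)\cap\mathcal D(C_B)$ and the following conditions are equivalent: (i) $\mathcal D(C_B)\subseteq\mathcal D(C_A)$ and $\|C_Af\|\le\|C_Bf\|$ for all $f\in\mathcal D(C_B)$; (ii) $\|C_Af\|\le\|C_Bf\|$ for all $f\in\mathcal K^\Phi$; (iii) $\|A^*\xi\|\le\|B^*\xi\|$ for all $\xi\in\mathcal H$. Moreover, $C_A$ is densely defined, $C_A$ is cohyponormal if and only if $A$ is hyponormal, and $C_A$ is hyponormal if and only if $A$ is cohyponormal. -/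

import Mathlib

open scoped ComplexOrder InnerProductSpace

/-- The class `𝓕` of entire functions `Φ(z) = ∑ aₙ zⁿ` on `ℂ` whose Taylor coefficients at the
origin are nonnegative, with `aₙ > 0` for at least one `n ≥ 1`. -/
structure FClass where
  toFun : ℂ → ℂ
  exists_coeff : ∃ a : ℕ → ℝ, (∀ k, 0 ≤ a k) ∧ (∃ n, 1 ≤ n ∧ 0 < a n) ∧
    ∀ z : ℂ, HasSum (fun n : ℕ => (a n : ℂ) * z ^ n) (toFun z)

section Kernel

variable (Φ : FClass) (H : Type*) [NormedAddCommGroup H] [InnerProductSpace ℂ H]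

/-- The kernel `K^Φ(ξ, η) = Φ(⟨ξ, η⟩)`, where `⟨·, ·⟩` is linear in the first variable, so that it
is `inner ℂ η ξ` in Mathlib's convention. -/
noncomputable def phiKernel (ξ η : H) : ℂ := Φ.toFun (inner ℂ η ξ)

/-- The scalar kernel `K^Φ` as an operator valued kernel (multiplication by the scalar on `ℂ`),
which is the form in which Mathlib takes kernels. -/
noncomputable def phiMatrix : Matrix H H (ℂ →L[ℂ] ℂ) :=
  Matrix.of fun ξ η => phiKernel Φ H ξ η • ContinuousLinearMap.id ℂ ℂ

theorem posSemidef_inner :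
    (Matrix.of fun ξ η : H => (inner ℂ η ξ : ℂ)).PosSemidef := by
  refine ⟨?_, fun x => ?_⟩
  · ext i j
    simp [Matrix.conjTranspose_apply]
  · have h : (x.sum fun i xi => x.sum fun j xj => star xi * (inner ℂ j i : ℂ) * xj) =
        inner ℂ (x.sum fun j xj => star xj • j) (x.sum fun j xj => star xj • j) := by
      simp only [Finsupp.sum, inner_sum, sum_inner, inner_smul_left, inner_smul_right]
      refine Finset.sum_congr rfl fun i _ => ?_
      rw [Finset.mul_sum]
      refine Finset.sum_congr rfl fun j _ => ?_
      simp only [RCLike.star_def, Complex.conj_conj]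
      ring
    simp only [Matrix.of_apply]
    rw [h, inner_self_eq_norm_sq_to_K, ← RCLike.ofReal_pow]
    have h0 : (0 : ℝ) ≤ ‖x.sum fun j xj => star xj • j‖ ^ 2 := sq_nonneg _
    exact Complex.zero_le_real.2 h0

theorem posSemidef_inner_pow (n : ℕ) :
    (Matrix.of fun ξ η : H => (inner ℂ η ξ : ℂ) ^ n).PosSemidef := by
  induction n with
  | zero =>
    refine ⟨?_, fun x => ?_⟩
    · ext i j
      simp [Matrix.conjTranspose_apply]
    · have h : (x.sum fun i xi => x.sum fun j xj => star xi * 1 * xj) =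
          star (∑ j ∈ x.support, x j) * (∑ j ∈ x.support, x j) := by
        simp [Finsupp.sum, Finset.sum_mul_sum]
      simp only [Matrix.of_apply, pow_zero]
      rw [h]
      exact star_mul_self_nonneg _
  | succ n ih =>
    have h := ih.hadamard (posSemidef_inner H)
    have e : (Matrix.of fun ξ η : H => (inner ℂ η ξ : ℂ) ^ (n + 1)) =
        Matrix.hadamard (Matrix.of fun ξ η : H => (inner ℂ η ξ : ℂ) ^ n)
          (Matrix.of fun ξ η : H => (inner ℂ η ξ : ℂ)) := by
      ext i j
      simp [pow_succ]
    rw [e]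
    exact h

theorem phiKernel_conj_symm (ξ η : H) :
    (starRingEnd ℂ) (phiKernel Φ H ξ η) = phiKernel Φ H η ξ := by
  obtain ⟨a, -, -, h⟩ := Φ.exists_coeff
  have h1 := (Complex.hasSum_conj'.2 (h (inner ℂ η ξ)))
  simp only [map_mul, map_pow, Complex.conj_ofReal, inner_conj_symm] at h1
  exact h1.unique (h (inner ℂ ξ η))

theorem posSemidef_phiKernel : (Matrix.of (phiKernel Φ H)).PosSemidef := by
  refine ⟨?_, fun x => ?_⟩
  · ext i j
    simpa [Matrix.conjTranspose_apply] using phiKernel_conj_symm Φ H j i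
  · obtain ⟨a, ha, -, h⟩ := Φ.exists_coeff
    have key : HasSum (fun n : ℕ => (a n : ℂ) * x.sum fun i xi => x.sum fun j xj =>
        star xi * (inner ℂ j i : ℂ) ^ n * xj)
        (x.sum fun i xi => x.sum fun j xj => star xi * Matrix.of (phiKernel Φ H) i j * xj) := by
      simp only [Finsupp.sum, Finset.mul_sum]
      refine hasSum_sum fun i _ => hasSum_sum fun j _ => ?_
      have := ((h (inner ℂ j i)).mul_left (star (x i))).mul_right (x j)
      have e : (fun n : ℕ => (a n : ℂ) * (star (x i) * (inner ℂ j i : ℂ) ^ n * x j)) =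
          fun n : ℕ => star (x i) * ((a n : ℂ) * (inner ℂ j i : ℂ) ^ n) * x j := by
        ext n
        ring
      rw [e]
      exact this
    refine key.nonneg fun n => mul_nonneg (by exact_mod_cast ha n) ?_
    exact (posSemidef_inner_pow H n).2 x

theorem posSemidef_phiMatrix : (phiMatrix Φ H).PosSemidef := by
  have t := (RKHS.posSemidef_tfae (K := phiMatrix Φ H)).out 0 2
  apply t.2
  refine ⟨?_, fun v => ?_⟩
  · ext i j
    have e : star (ContinuousLinearMap.id ℂ ℂ) = ContinuousLinearMap.id ℂ ℂ :=
      star_one (ℂ →L[ℂ] ℂ)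
    simp [phiMatrix, Matrix.conjTranspose_apply, phiKernel_conj_symm, e]
  · have := (posSemidef_phiKernel Φ H).2 v
    refine (Complex.le_def.1 (this.trans_eq ?_)).1
    refine Finsupp.sum_congr fun i _ => Finsupp.sum_congr fun j _ => ?_
    simp [phiMatrix, phiKernel_conj_symm]
    ring

instance : Fact (phiMatrix Φ H).PosSemidef := ⟨posSemidef_phiMatrix Φ H⟩

/-- The reproducing kernel Hilbert space `Φ(H)` with reproducing kernel `K^Φ`. Its elements are
functions `H → ℂ` through the `RKHS` coercion. -/
abbrev PhiSpace : Type _ := RKHS.OfKernel (phiMatrix Φ H)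

/-- The reproducing kernel of `Φ(H)` is `K^Φ`. -/
theorem kerFun_apply_eq_phiKernel (ξ η : H) :
    RKHS.kerFun (PhiSpace Φ H) η (1 : ℂ) ξ = phiKernel Φ H ξ η := by
  rw [RKHS.kerFun_apply, RKHS.OfKernel.kernel_ofKernel]
  simp [phiMatrix]

/-- The linear span `𝒦^Φ` of the kernel functions `K^Φ_ξ = K^Φ(·, ξ)`, `ξ ∈ H`. -/
noncomputable def kernelSpan : Submodule ℂ (PhiSpace Φ H) :=
  Submodule.span ℂ (Set.range fun ξ : H => RKHS.kerFun (PhiSpace Φ H) ξ (1 : ℂ))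

variable {H}

/-- The domain of the composition operator with symbol `φ`: all `f ∈ Φ(H)` such that
`f ∘ φ ∈ Φ(H)`. -/
def compOpDomain (φ : H → H) : Submodule ℂ (PhiSpace Φ H) where
  carrier := {f | ∃ g : PhiSpace Φ H, ∀ ξ, g ξ = f (φ ξ)}
  zero_mem' := ⟨0, by simp⟩
  add_mem' := by
    rintro f₁ f₂ ⟨g₁, h₁⟩ ⟨g₂, h₂⟩
    exact ⟨g₁ + g₂, by simp [h₁, h₂]⟩
  smul_mem' := by
    rintro c f ⟨g, h⟩
    exact ⟨c • g, by simp [h]⟩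

theorem exists_of_mem_compOpDomain {φ : H → H} (f : compOpDomain Φ φ) :
    ∃ g : PhiSpace Φ H, ∀ ξ, g ξ = (f : PhiSpace Φ H) (φ ξ) := f.2

/-- The (in general unbounded) composition operator `C_φ` in `Φ(H)` with symbol `φ`:
`C_φ f = f ∘ φ` for `f` in its domain. -/
noncomputable def compOp (φ : H → H) : PhiSpace Φ H →ₗ.[ℂ] PhiSpace Φ H where
  domain := compOpDomain Φ φ
  toFun :=
    { toFun := fun f => Classical.choose (exists_of_mem_compOpDomain Φ f)
      map_add' := fun f₁ f₂ => RKHS.ext fun ξ => by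
        rw [Classical.choose_spec (exists_of_mem_compOpDomain Φ (f₁ + f₂)) ξ, RKHS.coe_add,
          Pi.add_apply, Classical.choose_spec (exists_of_mem_compOpDomain Φ f₁) ξ,
          Classical.choose_spec (exists_of_mem_compOpDomain Φ f₂) ξ]
        simp
      map_smul' := fun c f => RKHS.ext fun ξ => by
        rw [Classical.choose_spec (exists_of_mem_compOpDomain Φ (c • f)) ξ, RingHom.id_apply,
          RKHS.coe_smul, Pi.smul_apply, Classical.choose_spec (exists_of_mem_compOpDomain Φ f) ξ]
        simp }

theorem mem_compOp_domain {φ : H → H} {f : PhiSpace Φ H} :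
    f ∈ (compOp Φ φ).domain ↔ ∃ g : PhiSpace Φ H, ∀ ξ, g ξ = f (φ ξ) := Iff.rfl

theorem compOp_apply (φ : H → H) (f : (compOp Φ φ).domain) (ξ : H) :
    compOp Φ φ f ξ = (f : PhiSpace Φ H) (φ ξ) := 
  Classical.choose_spec (exists_of_mem_compOpDomain Φ f) ξ

end Kernel

section Seminormal

variable {E : Type*} [NormedAddCommGroup E] [InnerProductSpace ℂ E] [CompleteSpace E]

/-- A densely defined operator `T` in a Hilbert space is hyponormal if `D(T) ⊆ D(T*)` and
`‖T* ξ‖ ≤ ‖T ξ‖` for all `ξ ∈ D(T)`. -/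
def IsHyponormalOp (T : E →ₗ.[ℂ] E) : Prop :=
  Dense (T.domain : Set E) ∧ ∃ h : T.domain ≤ T.adjoint.domain,
    ∀ ξ : T.domain, ‖T.adjoint ⟨ξ, h ξ.2⟩‖ ≤ ‖T ξ‖

/-- A densely defined operator `T` in a Hilbert space is cohyponormal if `D(T*) ⊆ D(T)` and
`‖T ξ‖ ≤ ‖T* ξ‖` for all `ξ ∈ D(T*)`. -/
def IsCohyponormalOp (T : E →ₗ.[ℂ] E) : Prop :=
  Dense (T.domain : Set E) ∧ ∃ h : T.adjoint.domain ≤ T.domain,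
    ∀ ξ : T.adjoint.domain, ‖T ⟨ξ, h ξ.2⟩‖ ≤ ‖T.adjoint ξ‖

/-- A bounded everywhere defined operator as an operator with domain the whole space. -/
def ContinuousLinearMap.toOp (A : E →L[ℂ] E) : E →ₗ.[ℂ] E := A.toLinearMap.toPMap ⊤

end Seminormal

/-! If `‖A*ξ‖ ≤ ‖B*ξ‖` everywhere, Douglas' factorisation gives a contraction `C` with `A* = C B*`,
hence `A = B C*` and `f ∘ A = (f ∘ B) ∘ C*`. Composition with a contraction is a contraction of
`Φ(H)` (`exists_contraction_comp`, by Schur products), so `C_B` dominates `C_A`. Conversely `C_A K_ξ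
= K_{A*ξ}` and `‖K_ξ‖² = Φ(‖ξ‖²)` is strictly increasing in `‖ξ‖`, so testing on kernel functions
recovers the inequality for adjoints.

The seminormality claims are this equivalence for the pair `A`, `A*`, once `(C_A)* = C_{A*}` is
known (`compOp_adjoint_eq`). The hard inclusion is that the two operators, on their maximal domains,
are formally adjoint. Composition with a small dilation makes everything bounded, and the mean
ergodic theorem removes the dilation. -/

section Douglas

/-! ### Douglas factorisation -/

variable {E F G : Type*} [AddCommGroup E] [Module ℂ E]
  [NormedAddCommGroup F] [InnerProductSpace ℂ F] [CompleteSpace F]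
  [NormedAddCommGroup G] [InnerProductSpace ℂ G] [CompleteSpace G]

/-- A linear map dominated in norm by another one factors through it by a contraction. -/
theorem exists_contraction_factor (f : E →ₗ[ℂ] F) (g : E →ₗ[ℂ] G) (h : ∀ x, ‖f x‖ ≤ ‖g x‖) :
    ∃ C : G →L[ℂ] F, ‖C‖ ≤ 1 ∧ ∀ x, C (g x) = f x := by
  -- `f` induces a contraction on the range of `g`; it is extended by continuity to the closure `M`,
  -- and by zero on the orthogonal complement.
  set M : Submodule ℂ G := (LinearMap.range g).topologicalClosure with hM
  have hmem : ∀ x, g x ∈ M := fun x => Submodule.le_topologicalClosure _ ⟨x, rfl⟩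
  have : CompleteSpace M := (Submodule.isClosed_topologicalClosure _).completeSpace_coe
  let g' : E →ₗ[ℂ] M := g.codRestrict M hmem
  have hd : DenseRange g' := by
    intro y
    rw [Topology.IsInducing.subtypeVal.closure_eq_preimage_closure_image]
    have hy : (y : G) ∈ closure (LinearMap.range g : Set G) := y.2
    refine closure_mono ?_ hy
    rintro _ ⟨x, rfl⟩
    exact ⟨g' x, ⟨x, rfl⟩, rfl⟩
  have hb : ∀ x, ‖f x‖ ≤ 1 * ‖g' x‖ := fun x => by simpa [g'] using h x
  refine ⟨(f.extendOfNorm g').comp M.orthogonalProjectionOnto, ?_, fun x => ?_⟩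
  · refine (ContinuousLinearMap.opNorm_comp_le _ _).trans ?_
    have h1 := LinearMap.opNorm_extendOfNorm_le (f := f) (e := g') hd zero_le_one hb
    have h2 := M.orthogonalProjectionOnto_norm_le
    exact mul_le_one₀ h1 (norm_nonneg _) h2
  · have e : M.orthogonalProjectionOnto (g x) = g' x :=
      M.orthogonalProjectionOnto_mem_subspace_eq_self (g' x)
    rw [ContinuousLinearMap.comp_apply, e]
    exact LinearMap.extendOfNorm_eq hd ⟨1, hb⟩ x

end Douglas

/-! ### Composition with a contraction -/

section Contraction

variable {H : Type*} [NormedAddCommGroup H] [InnerProductSpace ℂ H]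

/-- The quadratic form is `‖v‖² - ‖T v‖²` with `v = ∑ conj (x j) • j`. -/
theorem posSemidef_inner_sub_inner_map (T : H →L[ℂ] H) (hT : ‖T‖ ≤ 1) :
    (Matrix.of fun ξ η : H => (inner ℂ η ξ : ℂ) - inner ℂ (T η) (T ξ)).PosSemidef := by
  refine ⟨?_, fun x => ?_⟩
  · ext i j
    simp [Matrix.conjTranspose_apply]
  · have h : (x.sum fun i xi => x.sum fun j xj =>
        star xi * ((inner ℂ j i : ℂ) - inner ℂ (T j) (T i)) * xj) =
        inner ℂ (x.sum fun j xj => star xj • j) (x.sum fun j xj => star xj • j) -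
        inner ℂ (T (x.sum fun j xj => star xj • j)) (T (x.sum fun j xj => star xj • j)) := by
      simp only [Finsupp.sum, map_sum, map_smul, inner_sum, sum_inner, inner_smul_left,
        inner_smul_right, ← Finset.sum_sub_distrib]
      refine Finset.sum_congr rfl fun i _ => ?_
      rw [Finset.mul_sum, Finset.mul_sum, ← Finset.sum_sub_distrib]
      refine Finset.sum_congr rfl fun j _ => ?_
      simp only [RCLike.star_def, Complex.conj_conj]
      ring
    simp only [Matrix.of_apply]
    rw [h, inner_self_eq_norm_sq_to_K, inner_self_eq_norm_sq_to_K, ← RCLike.ofReal_pow,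
      ← RCLike.ofReal_pow, ← RCLike.ofReal_sub]
    refine Complex.zero_le_real.2 (sub_nonneg.2 ?_)
    exact pow_le_pow_left₀ (norm_nonneg _) (T.le_of_opNorm_le hT _ |>.trans_eq (one_mul _)) 2

/-- Induction through `s^(n+1) - t^(n+1) = s^n (s - t) + (s^n - t^n) t` and the Schur product
theorem. -/
theorem posSemidef_inner_pow_sub_inner_map_pow (T : H →L[ℂ] H) (hT : ‖T‖ ≤ 1) (n : ℕ) :
    (Matrix.of fun ξ η : H => (inner ℂ η ξ : ℂ) ^ n - inner ℂ (T η) (T ξ) ^ n).PosSemidef := by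
  induction n with
  | zero =>
    have e : (Matrix.of fun ξ η : H => (inner ℂ η ξ : ℂ) ^ 0 - inner ℂ (T η) (T ξ) ^ 0) = 0 := by
      ext i j
      simp
    rw [e]
    exact Matrix.PosSemidef.zero
  | succ n ih =>
    have h := ((posSemidef_inner_pow H n).hadamard (posSemidef_inner_sub_inner_map T hT)).add
      (ih.hadamard ((posSemidef_inner H).submatrix T))
    refine Eq.subst (motive := Matrix.PosSemidef) ?_ h
    ext i j
    simp
    ring

theorem posSemidef_phiKernel_sub_map (Φ : FClass) (T : H →L[ℂ] H) (hT : ‖T‖ ≤ 1) :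
    (Matrix.of fun ξ η : H => phiKernel Φ H ξ η - phiKernel Φ H (T ξ) (T η)).PosSemidef := by
  refine ⟨?_, fun x => ?_⟩
  · ext i j
    simp [Matrix.conjTranspose_apply, phiKernel_conj_symm]
  · obtain ⟨a, ha, -, h⟩ := Φ.exists_coeff
    have key : HasSum (fun n : ℕ => (a n : ℂ) * x.sum fun i xi => x.sum fun j xj =>
        star xi * ((inner ℂ j i : ℂ) ^ n - inner ℂ (T j) (T i) ^ n) * xj)
        (x.sum fun i xi => x.sum fun j xj => star xi *
          (phiKernel Φ H i j - phiKernel Φ H (T i) (T j)) * xj) := by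
      simp only [Finsupp.sum, Finset.mul_sum]
      refine hasSum_sum fun i _ => hasSum_sum fun j _ => ?_
      have := (((h (inner ℂ j i)).sub (h (inner ℂ (T j) (T i)))).mul_left
        (star (x i))).mul_right (x j)
      refine Eq.subst (motive := fun u => HasSum u _) (funext fun n => ?_) this
      ring
    exact key.nonneg fun n => mul_nonneg (by exact_mod_cast ha n)
      ((posSemidef_inner_pow_sub_inner_map_pow T hT n).2 x)

/-- The kernel function `K^Φ_ξ` as an element of `Φ(H)`. -/
noncomputable def kernelVec (Φ : FClass) (ξ : H) : PhiSpace Φ H :=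
  RKHS.kerFun (PhiSpace Φ H) ξ (1 : ℂ)

variable (Φ : FClass)

theorem inner_kernelVec_left (ξ : H) (f : PhiSpace Φ H) : inner ℂ (kernelVec Φ ξ) f = f ξ := by
  simp [kernelVec]

theorem kernelVec_apply (ξ η : H) : kernelVec Φ η ξ = phiKernel Φ H ξ η :=
  kerFun_apply_eq_phiKernel Φ H ξ η

theorem norm_linearCombination_kernelVec_sq {ι : Type*} (u : ι → H) (x : ι →₀ ℂ) :
    ((‖Finsupp.linearCombination ℂ (fun i => kernelVec Φ (u i)) x‖ ^ 2 : ℝ) : ℂ) =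
      x.sum fun i xi => x.sum fun j xj => star xi * phiKernel Φ H (u i) (u j) * xj := by
  have h := inner_self_eq_norm_sq_to_K (𝕜 := ℂ)
    (Finsupp.linearCombination ℂ (fun i => kernelVec Φ (u i)) x)
  push_cast
  refine h.symm.trans ?_
  simp only [Finsupp.linearCombination_apply, Finsupp.sum, sum_inner, inner_sum, inner_smul_left,
    inner_smul_right, inner_kernelVec_left, kernelVec_apply, Finset.mul_sum]
  rw [Finset.sum_comm]
  refine Finset.sum_congr rfl fun i _ => Finset.sum_congr rfl fun j _ => ?_
  simp only [RCLike.star_def]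
  ring

/-- Positivity of the kernel difference says that `K_ξ ↦ K_{Tξ}` is contractive on linear
combinations. The adjoint of its extension is composition with `T`. -/
theorem exists_contraction_comp [CompleteSpace H] (T : H →L[ℂ] H) (hT : ‖T‖ ≤ 1) :
    ∃ V : PhiSpace Φ H →L[ℂ] PhiSpace Φ H, ‖V‖ ≤ 1 ∧ ∀ f ξ, V f ξ = f (T ξ) := by
  obtain ⟨C, hC, h⟩ := exists_contraction_factor
    -- Formal combinations in `H →₀ ℂ` allow for linear dependence among kernel functions.
    (Finsupp.linearCombination ℂ (fun ξ : H => kernelVec Φ (T ξ)))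
    (Finsupp.linearCombination ℂ (fun ξ : H => kernelVec Φ ξ)) (fun x => by
      refine le_of_sq_le_sq ?_ (norm_nonneg _)
      rw [← Complex.real_le_real, norm_linearCombination_kernelVec_sq Φ (fun ξ => T ξ),
        norm_linearCombination_kernelVec_sq Φ (fun ξ => ξ), ← sub_nonneg]
      refine ((posSemidef_phiKernel_sub_map Φ T hT).2 x).trans_eq ?_
      simp only [Finsupp.sum, ← Finset.sum_sub_distrib, Matrix.of_apply]
      refine Finset.sum_congr rfl fun i _ => Finset.sum_congr rfl fun j _ => ?_
      ring)
  refine ⟨ContinuousLinearMap.adjoint C, by simpa using hC, fun f ξ => ?_⟩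
  have e := h (Finsupp.single ξ 1)
  simp only [Finsupp.linearCombination_single, one_smul] at e
  rw [← inner_kernelVec_left, ContinuousLinearMap.adjoint_inner_right, e, inner_kernelVec_left]

end Contraction

/-! ### Composition operators: domination and adjoints -/

section CompositionOperator

variable {H : Type*} [NormedAddCommGroup H] [InnerProductSpace ℂ H]

theorem kernelSpan_eq_span_range_kernelVec (Φ : FClass) :
    kernelSpan Φ H = Submodule.span ℂ (Set.range (kernelVec Φ : H → PhiSpace Φ H)) := rfl

theorem dense_kernelSpan (Φ : FClass) : Dense (kernelSpan Φ H : Set (PhiSpace Φ H)) := by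
  rw [Submodule.dense_iff_topologicalClosure_eq_top, Submodule.topologicalClosure_eq_top_iff,
    Submodule.eq_bot_iff]
  intro f hf
  refine RKHS.ext fun ξ => ?_
  rw [← inner_kernelVec_left]
  simpa using (Submodule.mem_orthogonal _ _).1 hf (kernelVec Φ ξ)
    (Submodule.subset_span ⟨ξ, rfl⟩)

theorem hasSum_norm_kernelVec_sq {Φ : FClass} {a : ℕ → ℝ}
    (h : ∀ z : ℂ, HasSum (fun n : ℕ => (a n : ℂ) * z ^ n) (Φ.toFun z)) (ξ : H) :
    HasSum (fun n : ℕ => a n * (‖ξ‖ ^ 2) ^ n) (‖kernelVec Φ ξ‖ ^ 2) := by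
  have e : Φ.toFun (inner ℂ ξ ξ) = ((‖kernelVec Φ ξ‖ ^ 2 : ℝ) : ℂ) := by
    have h1 := inner_self_eq_norm_sq_to_K (𝕜 := ℂ) (kernelVec Φ ξ)
    rw [inner_kernelVec_left, kernelVec_apply] at h1
    push_cast
    exact h1
  have h2 := h (inner ℂ ξ ξ)
  rw [e, inner_self_eq_norm_sq_to_K] at h2
  refine Complex.hasSum_ofReal.1 (Eq.subst (motive := fun u => HasSum u _) (funext fun n => ?_) h2)
  push_cast
  rfl

/-- The positive coefficient of index `n ≥ 1` makes `Φ` strictly increasing on `[0, ∞)`. -/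
theorem norm_le_norm_of_norm_kernelVec_le (Φ : FClass) {ξ η : H}
    (h : ‖kernelVec Φ ξ‖ ≤ ‖kernelVec Φ η‖) : ‖ξ‖ ≤ ‖η‖ := by
  by_contra! hlt
  obtain ⟨a, ha, ⟨n, hn, han⟩, hs⟩ := Φ.exists_coeff
  have hsq : ‖η‖ ^ 2 < ‖ξ‖ ^ 2 := pow_lt_pow_left₀ hlt (norm_nonneg _) two_ne_zero
  have h1 : ‖kernelVec Φ η‖ ^ 2 < ‖kernelVec Φ ξ‖ ^ 2 :=
    hasSum_lt (i := n)
      (fun k => mul_le_mul_of_nonneg_left (pow_le_pow_left₀ (sq_nonneg _) hsq.le k) (ha k))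
      (mul_lt_mul_of_pos_left (pow_lt_pow_left₀ hsq (sq_nonneg _) (by omega)) han)
      (hasSum_norm_kernelVec_sq hs η) (hasSum_norm_kernelVec_sq hs ξ)
  exact h1.not_ge (pow_le_pow_left₀ (norm_nonneg _) h 2)

variable [CompleteSpace H] (Φ : FClass) (A B : H →L[ℂ] H)

open ContinuousLinearMap (adjoint)

theorem kernelVec_adjoint_apply (ξ η : H) :
    kernelVec Φ (adjoint A η) ξ = kernelVec Φ η (A ξ) := by
  simp only [kernelVec_apply, phiKernel, ContinuousLinearMap.adjoint_inner_left]

theorem kernelVec_mem_compOp_domain (ξ : H) : kernelVec Φ ξ ∈ (compOp Φ A).domain :=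
  (mem_compOp_domain Φ).2 ⟨kernelVec Φ (adjoint A ξ), fun η => kernelVec_adjoint_apply Φ A η ξ⟩

theorem compOp_kernelVec {ξ : H} (h : kernelVec Φ ξ ∈ (compOp Φ A).domain) :
    compOp Φ A ⟨kernelVec Φ ξ, h⟩ = kernelVec Φ (adjoint A ξ) :=
  RKHS.ext fun η => by rw [compOp_apply, kernelVec_adjoint_apply]

theorem kernelSpan_le_compOp_domain : kernelSpan Φ H ≤ (compOp Φ A).domain := by
  rw [kernelSpan_eq_span_range_kernelVec, Submodule.span_le]
  rintro _ ⟨ξ, rfl⟩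
  exact kernelVec_mem_compOp_domain Φ A ξ

theorem dense_compOp_domain : Dense ((compOp Φ A).domain : Set (PhiSpace Φ H)) :=
  (dense_kernelSpan Φ).mono (kernelSpan_le_compOp_domain Φ A)

variable {A B}

theorem compOp_domain_le_and_norm_le (h : ∀ ξ, ‖adjoint A ξ‖ ≤ ‖adjoint B ξ‖) :
    ∃ h : (compOp Φ B).domain ≤ (compOp Φ A).domain,
      ∀ f : (compOp Φ B).domain, ‖compOp Φ A ⟨f, h f.2⟩‖ ≤ ‖compOp Φ B f‖ := by
  obtain ⟨C, hC, hCB⟩ := exists_contraction_factor (adjoint A).toLinearMap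
    (adjoint B).toLinearMap h
  obtain ⟨V, hV, hVf⟩ := exists_contraction_comp Φ (adjoint C) (by simpa using hC)
  have hBA : ∀ ξ, B (adjoint C ξ) = A ξ := fun ξ => ext_inner_left ℂ fun η => by
    rw [← ContinuousLinearMap.adjoint_inner_left, ContinuousLinearMap.adjoint_inner_right,
      ← ContinuousLinearMap.adjoint_inner_left A]
    exact congrArg (fun x => inner ℂ x ξ) (hCB η)
  have hVB : ∀ (f : (compOp Φ B).domain) ξ,
      V (compOp Φ B f) ξ = (f : PhiSpace Φ H) (A ξ) := fun f ξ => by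
    rw [hVf, compOp_apply, hBA]
  refine ⟨fun f hf => ⟨V (compOp Φ B ⟨f, hf⟩), hVB ⟨f, hf⟩⟩, fun f => ?_⟩
  have hf : (f : PhiSpace Φ H) ∈ (compOp Φ A).domain := ⟨V (compOp Φ B f), hVB f⟩
  have e : compOp Φ A ⟨f, hf⟩ = V (compOp Φ B f) :=
    RKHS.ext fun ξ => by rw [compOp_apply, hVB]
  change ‖compOp Φ A ⟨f, hf⟩‖ ≤ _
  rw [e]
  exact (V.le_of_opNorm_le hV _).trans_eq (one_mul _)

variable {Φ}

theorem norm_adjoint_le_of_norm_compOp_kernelVec_le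
    (h : ∀ ξ : H, ‖compOp Φ A ⟨_, kernelVec_mem_compOp_domain Φ A ξ⟩‖ ≤
      ‖compOp Φ B ⟨_, kernelVec_mem_compOp_domain Φ B ξ⟩‖) (ξ : H) :
    ‖adjoint A ξ‖ ≤ ‖adjoint B ξ‖ := by
  have := h ξ
  rw [compOp_kernelVec, compOp_kernelVec] at this
  exact norm_le_norm_of_norm_kernelVec_le Φ this

variable (Φ A)

/-- For bounded composition operators, evaluating on kernel functions, where `V K_ξ = K_{T*ξ}`,
already identifies the adjoint. -/
theorem inner_comp_eq_inner_comp_adjoint {T : H →L[ℂ] H} {V V' : PhiSpace Φ H →L[ℂ] PhiSpace Φ H}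
    (hV : ∀ f ξ, V f ξ = f (T ξ)) (hV' : ∀ f ξ, V' f ξ = f (adjoint T ξ)) (f g : PhiSpace Φ H) :
    inner ℂ (V f) g = inner ℂ f (V' g) := by
  have hK : ∀ ξ, V (kernelVec Φ ξ) = kernelVec Φ (adjoint T ξ) := fun ξ =>
    RKHS.ext fun η => by rw [hV, kernelVec_adjoint_apply]
  have e : adjoint V g = V' g := RKHS.ext fun ξ => by
    rw [← inner_kernelVec_left, ContinuousLinearMap.adjoint_inner_right, hK,
      inner_kernelVec_left, hV']
  rw [← e, ContinuousLinearMap.adjoint_inner_right]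

/-- Birkhoff averages of a contraction of a Hilbert space without nonzero fixed points converge
strongly to zero. -/
theorem tendsto_birkhoffAverage_zero {E : Type*} [NormedAddCommGroup E]
    [InnerProductSpace ℂ E] [CompleteSpace E] {S : E →L[ℂ] E} (hS : ‖S‖ ≤ 1)
    (hfix : ∀ x, S x = x → x = 0) (x : E) :
    Filter.Tendsto (birkhoffAverage ℂ S id · x) Filter.atTop (nhds 0) := by
  have h := S.tendsto_birkhoffAverage_orthogonalProjection hS x
  rwa [hfix _ ((S.eqLocus (1 : E →L[ℂ] E)).orthogonalProjectionOnto x).2] at h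

theorem norm_one_sub_comp_self_le_one {E : Type*} [NormedAddCommGroup E] [InnerProductSpace ℂ E]
    {Q : E →L[ℂ] E} (hQ : ‖Q‖ ≤ 1) (hsymm : ∀ x y, inner ℂ (Q x) y = inner ℂ x (Q y)) :
    ‖1 - Q.comp Q‖ ≤ 1 := by
  refine ContinuousLinearMap.opNorm_le_bound _ zero_le_one fun x => ?_
  rw [one_mul]
  refine le_of_sq_le_sq ?_ (norm_nonneg _)
  have h1 : ‖Q (Q x)‖ ≤ ‖Q x‖ := (Q.le_of_opNorm_le hQ _).trans_eq (one_mul _)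
  have h2 : RCLike.re (inner ℂ x (Q (Q x))) = ‖Q x‖ ^ 2 := by
    rw [← hsymm, inner_self_eq_norm_sq]
  -- `‖x - Q²x‖² = ‖x‖² - 2‖Qx‖² + ‖Q²x‖² ≤ ‖x‖² - ‖Qx‖²`.
  have h3 := norm_sub_sq (𝕜 := ℂ) x (Q (Q x))
  rw [h2] at h3
  have h4 := pow_le_pow_left₀ (norm_nonneg _) h1 2
  have h5 : (1 - Q.comp Q) x = x - Q (Q x) := rfl
  rw [h5]
  nlinarith [sq_nonneg ‖Q x‖]

/-- Let `Q` be composition with a dilation `D` and `S = 1 - Q²`. The defect `δ` of the adjoint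
relation does not change when `f` and `C_{A*} f` are replaced by their images under `S`, hence under
its Birkhoff averages. These tend to zero, so the defect is zero. -/
theorem isFormalAdjoint_compOp_adjoint :
    (compOp Φ A).IsFormalAdjoint (compOp Φ (adjoint A)) := by
  intro g f
  -- This choice gives `0 < q ≤ 1` and `q‖A‖ ≤ 1`, so both `D = q` and `A D²` are contractions, and
  -- `D` is invertible.
  set q : ℝ := (1 + ‖A‖)⁻¹ with hq
  have hpos : 0 < 1 + ‖A‖ := by positivity
  have hq0 : 0 < q := inv_pos.2 hpos
  have hq1 : q ≤ 1 := inv_le_one_of_one_le₀ (by linarith [norm_nonneg A])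
  have hqA : q * ‖A‖ ≤ 1 := by
    rw [hq, inv_mul_le_one₀ hpos]
    linarith
  let D : H →L[ℂ] H := (q : ℂ) • 1
  have hDadj : adjoint D = D := by
    ext ξ
    refine ext_inner_left ℂ fun η => ?_
    simp [D, ContinuousLinearMap.adjoint_inner_right]
  have hD : ‖D‖ ≤ 1 := ContinuousLinearMap.opNorm_le_bound _ zero_le_one fun x => by
    have : ‖D x‖ = q * ‖x‖ := by simp [D, norm_smul, abs_of_pos hq0]
    rw [this]
    gcongr
  have hqne : (q : ℂ) ≠ 0 := by exact_mod_cast hq0.ne'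
  have hDsurj : ∀ ξ, ∃ η, D (D η) = ξ := fun ξ => ⟨(q : ℂ)⁻¹ • (q : ℂ)⁻¹ • ξ, by
    change (q : ℂ) • (q : ℂ) • (q : ℂ)⁻¹ • (q : ℂ)⁻¹ • ξ = ξ
    rw [smul_inv_smul₀ hqne, smul_inv_smul₀ hqne]⟩
  have hcomm : ∀ T : H →L[ℂ] H, ∀ ξ, T (D (D ξ)) = D (D (T ξ)) := fun T ξ => by simp [D]
  have hADD : ‖A.comp (D.comp D)‖ ≤ 1 :=
    ContinuousLinearMap.opNorm_le_bound _ zero_le_one fun x => by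
      have h1 : ‖A (D (D x))‖ ≤ ‖A‖ * (q * (q * ‖x‖)) :=
        (A.le_opNorm _).trans_eq (by simp [D, norm_smul, abs_of_pos hq0])
      have h2 : ‖A‖ * (q * (q * ‖x‖)) = (q * ‖A‖) * (q * ‖x‖) := by ring
      rw [h2] at h1
      exact h1.trans (mul_le_mul hqA (mul_le_of_le_one_left (norm_nonneg _) hq1) (by positivity)
        zero_le_one)
  obtain ⟨Q, hQ, hQf⟩ := exists_contraction_comp Φ D hD
  obtain ⟨W, -, hWf⟩ := exists_contraction_comp Φ (A.comp (D.comp D)) hADD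
  obtain ⟨W', -, hWf'⟩ := exists_contraction_comp Φ (adjoint (A.comp (D.comp D)))
    ((LinearIsometryEquiv.norm_map _ _).trans_le hADD)
  have hQsymm : ∀ x y, inner ℂ (Q x) y = inner ℂ x (Q y) :=
    inner_comp_eq_inner_comp_adjoint Φ hQf (by rwa [hDadj])
  set S : PhiSpace Φ H →L[ℂ] PhiSpace Φ H := 1 - Q.comp Q with hSdef
  have hSx : ∀ x, S x = x - Q (Q x) := fun x => rfl
  -- A fixed point satisfies `Q²x = 0`, so `x` vanishes on the range of `D²`, which is all of `H`.
  have hfix : ∀ x, S x = x → x = 0 := fun x hx => by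
    have h0 : Q (Q x) = 0 := by simpa [hSx] using hx
    refine RKHS.ext fun ξ => ?_
    obtain ⟨η, rfl⟩ := hDsurj ξ
    rw [← hQf, ← hQf, h0]
    simp
  have htend := tendsto_birkhoffAverage_zero (norm_one_sub_comp_self_le_one hQ hQsymm) hfix
  -- The defect vanishes on pairs `(Q²x, Q²y)`: moving `Q²` to the left turns `C_A g` into `g ∘ (A
  -- D²)`, a bounded composition whose adjoint is known.
  have hzero : ∀ x y : PhiSpace Φ H, (∀ ξ, y ξ = x (adjoint A ξ)) →
      inner ℂ (compOp Φ A g) (Q (Q x)) = inner ℂ (g : PhiSpace Φ H) (Q (Q y)) := by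
    intro x y hxy
    have h1 : Q (Q (compOp Φ A g)) = W g := RKHS.ext fun ξ => by
      rw [hQf, hQf, compOp_apply, hWf]
      rfl
    have h2 : W' x = Q (Q y) := RKHS.ext fun ξ => by
      rw [hQf, hQf, hxy, hWf', ContinuousLinearMap.adjoint_comp, ContinuousLinearMap.adjoint_comp,
        hDadj, hcomm]
      rfl
    rw [← hQsymm, ← hQsymm, h1, ← h2, inner_comp_eq_inner_comp_adjoint Φ hWf hWf']
  let δ : PhiSpace Φ H → PhiSpace Φ H → ℂ := fun x y =>
    inner ℂ (compOp Φ A g) x - inner ℂ (g : PhiSpace Φ H) y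
  have hiter : ∀ n : ℕ, (∀ ξ, (S^[n] (compOp Φ (adjoint A) f)) ξ = (S^[n] f) (adjoint A ξ)) ∧
      δ (S^[n] f) (S^[n] (compOp Φ (adjoint A) f)) = δ f (compOp Φ (adjoint A) f) := by
    intro n
    induction n with
    | zero => exact ⟨fun ξ => compOp_apply Φ _ f ξ, rfl⟩
    | succ n ih =>
      obtain ⟨h1, h2⟩ := ih
      simp only [Function.iterate_succ_apply']
      refine ⟨fun ξ => ?_, ?_⟩
      · simp only [hSx, RKHS.coe_sub, Pi.sub_apply, hQf, h1, hcomm]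
      · rw [← h2]
        simp only [δ, hSx, inner_sub_right, hzero _ _ h1]
        ring
  have havg : ∀ n : ℕ, n ≠ 0 → δ (birkhoffAverage ℂ S id n f)
      (birkhoffAverage ℂ S id n (compOp Φ (adjoint A) f)) = δ f (compOp Φ (adjoint A) f) := by
    intro n hn
    have hn' : (n : ℂ) ≠ 0 := by exact_mod_cast hn
    simp only [δ, birkhoffAverage, birkhoffSum, id, inner_smul_right, inner_sum, ← mul_sub,
      ← Finset.sum_sub_distrib]
    rw [Finset.sum_congr rfl fun k _ => (hiter k).2, Finset.sum_const, Finset.card_range,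
      nsmul_eq_mul, inv_mul_cancel_left₀ hn']
  have hlim : Filter.Tendsto (fun n => δ (birkhoffAverage ℂ S id n f)
      (birkhoffAverage ℂ S id n (compOp Φ (adjoint A) f))) Filter.atTop (nhds (δ 0 0)) :=
    (tendsto_const_nhds.inner (htend _)).sub (tendsto_const_nhds.inner (htend _))
  have hconst := hlim.congr' ((Filter.eventually_ne_atTop 0).mono havg)
  have h0 := tendsto_nhds_unique tendsto_const_nhds hconst
  simpa [δ, sub_eq_zero] using h0

/-- Pairing with kernel functions shows that `(C_A)*` acts as composition with `A*`; the reverse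
inclusion is the formal adjointness. -/
theorem compOp_adjoint_eq : (compOp Φ A).adjoint = compOp Φ (adjoint A) := by
  have hd := dense_compOp_domain Φ A
  have key : ∀ (g : (compOp Φ A).adjoint.domain) ξ,
      (compOp Φ A).adjoint g ξ = (g : PhiSpace Φ H) (adjoint A ξ) := fun g ξ => by
    have h := LinearPMap.adjoint_isFormalAdjoint hd g
      ⟨kernelVec Φ ξ, kernelVec_mem_compOp_domain Φ A ξ⟩
    rw [compOp_kernelVec, ← inner_conj_symm, ← inner_conj_symm (g : PhiSpace Φ H)] at h
    rw [← inner_kernelVec_left, ← inner_kernelVec_left]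
    exact (starRingEnd ℂ).injective h
  have hle : (compOp Φ A).adjoint ≤ compOp Φ (adjoint A) :=
    ⟨fun g hg => ⟨_, key ⟨g, hg⟩⟩, fun g g' hgg' => RKHS.ext fun ξ => by
      rw [key, compOp_apply, hgg']⟩
  exact le_antisymm hle
    (LinearPMap.IsFormalAdjoint.le_adjoint hd (isFormalAdjoint_compOp_adjoint Φ A))

end CompositionOperator

/-! ### Hyponormality and cohyponormality -/

section Seminormal

open ContinuousLinearMap (adjoint)

variable {E : Type*} [NormedAddCommGroup E] [InnerProductSpace ℂ E] [CompleteSpace E]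
  {T S : E →ₗ.[ℂ] E} (A : E →L[ℂ] E)

theorem isHyponormalOp_iff_of_adjoint_eq (hTS : T.adjoint = S) :
    IsHyponormalOp T ↔ Dense (T.domain : Set E) ∧ ∃ h : T.domain ≤ S.domain,
      ∀ ξ : T.domain, ‖S ⟨ξ, h ξ.2⟩‖ ≤ ‖T ξ‖ := by
  subst hTS
  rfl

theorem isCohyponormalOp_iff_of_adjoint_eq (hTS : T.adjoint = S) :
    IsCohyponormalOp T ↔ Dense (T.domain : Set E) ∧ ∃ h : S.domain ≤ T.domain,
      ∀ ξ : S.domain, ‖T ⟨ξ, h ξ.2⟩‖ ≤ ‖S ξ‖ := by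
  subst hTS
  rfl

theorem ContinuousLinearMap.adjoint_toOp : A.toOp.adjoint = (adjoint A).toOp :=
  A.toPMap_adjoint_eq_adjoint_toPMap_of_dense dense_univ

theorem isHyponormalOp_toOp_iff : IsHyponormalOp A.toOp ↔ ∀ ξ, ‖adjoint A ξ‖ ≤ ‖A ξ‖ := by
  rw [isHyponormalOp_iff_of_adjoint_eq A.adjoint_toOp]
  exact ⟨fun ⟨_, _, h⟩ ξ => h ⟨ξ, trivial⟩, fun h => ⟨dense_univ, le_rfl, fun ξ => h ξ⟩⟩

theorem isCohyponormalOp_toOp_iff : IsCohyponormalOp A.toOp ↔ ∀ ξ, ‖A ξ‖ ≤ ‖adjoint A ξ‖ := by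
  rw [isCohyponormalOp_iff_of_adjoint_eq A.adjoint_toOp]
  exact ⟨fun ⟨_, _, h⟩ ξ => h ⟨ξ, trivial⟩, fun h => ⟨dense_univ, le_rfl, fun ξ => h ξ⟩⟩

end Seminormal

theorem theorem10p2 {H : Type*} [NormedAddCommGroup H] [InnerProductSpace ℂ H] [CompleteSpace H]
    (Φ : FClass) (A B : H →L[ℂ] H) :
    (∃ (hA : kernelSpan Φ H ≤ (compOp Φ A).domain) (hB : kernelSpan Φ H ≤ (compOp Φ B).domain),
      List.TFAE [
        ∃ h : (compOp Φ B).domain ≤ (compOp Φ A).domain,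
          ∀ f : (compOp Φ B).domain, ‖compOp Φ A ⟨f, h f.2⟩‖ ≤ ‖compOp Φ B f‖,
        ∀ f : kernelSpan Φ H, ‖compOp Φ A ⟨f, hA f.2⟩‖ ≤ ‖compOp Φ B ⟨f, hB f.2⟩‖,
        ∀ ξ : H, ‖ContinuousLinearMap.adjoint A ξ‖ ≤ ‖ContinuousLinearMap.adjoint B ξ‖]) ∧
    Dense ((compOp Φ A).domain : Set (PhiSpace Φ H)) ∧
    (IsCohyponormalOp (compOp Φ A) ↔ IsHyponormalOp A.toOp) ∧
    (IsHyponormalOp (compOp Φ A) ↔ IsCohyponormalOp A.toOp) := by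
  refine ⟨⟨kernelSpan_le_compOp_domain Φ A, kernelSpan_le_compOp_domain Φ B, ?_⟩,
    dense_compOp_domain Φ A, ?_, ?_⟩
  · tfae_have 1 → 2 := fun ⟨_, h⟩ f => h ⟨f, kernelSpan_le_compOp_domain Φ B f.2⟩
    tfae_have 2 → 3 := fun h => norm_adjoint_le_of_norm_compOp_kernelVec_le
      fun ξ => h ⟨kernelVec Φ ξ, Submodule.subset_span ⟨ξ, rfl⟩⟩
    tfae_have 3 → 1 := compOp_domain_le_and_norm_le Φ
    tfae_finish
  -- Cohyponormality of `C_A` is now domination of `C_A` by `C_{A*}`, that is `‖A*ξ‖ ≤ ‖A**ξ‖ =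
  -- ‖Aξ‖`.
  · rw [isHyponormalOp_toOp_iff, isCohyponormalOp_iff_of_adjoint_eq (compOp_adjoint_eq Φ A)]
    constructor
    · rintro ⟨_, _, h⟩
      simpa using norm_adjoint_le_of_norm_compOp_kernelVec_le
        fun ξ => h ⟨kernelVec Φ ξ, kernelVec_mem_compOp_domain Φ _ ξ⟩
    · exact fun h => ⟨dense_compOp_domain Φ A, compOp_domain_le_and_norm_le Φ (by simpa using h)⟩
  · rw [isCohyponormalOp_toOp_iff, isHyponormalOp_iff_of_adjoint_eq (compOp_adjoint_eq Φ A)]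
    constructor
    · rintro ⟨_, _, h⟩
      simpa using norm_adjoint_le_of_norm_compOp_kernelVec_le
        fun ξ => h ⟨kernelVec Φ ξ, kernelVec_mem_compOp_domain Φ _ ξ⟩
    · exact fun h => ⟨dense_compOp_domain Φ A, compOp_domain_le_and_norm_le Φ (by simpa using h)⟩
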